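/- Identify a matroid over the ground set $\{1,\dots,n\}$ with the set $S\subset\{0,1\}^n$ of indicator vectors of its bases. For a $d\times n$ matrix $W$ let $WS=\{Wx : x\in S\}\subset\mathbb{R}^d$, and let $\mathrm{conv}(WS)$ be its convex hull. For every $d\ge 1$, the number of vertices of $\mathrm{conv}(WS)$, taken over all $n$, all matroids $S\subset\{0,1\}^n$ and all $\{0,1\}$-valued $d\times n$ matrices $W$, attains a (finite) maximum $m(d)$, and $$d\,2^d\ \le\ m(d)\ \le\ 2\sum_{k=0}^{d-1}\binom{\frac12(3^d-3)}{k},$$ where the right-hand side is $O\left(3^{d(d-1)}\right)$ as $d\to\infty$. For $d=1$ and $d=2$ the lower and upper bounds coincide, and $m(1)=2$ and $m(2)=8$. -/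

import Mathlib

open Asymptotics Filter

/-- A matroid with ground set `{1, …, n}` (here `Fin n`), identified with the set
`S ⊆ {0,1}ⁿ` of indicator vectors of its bases. -/
def IsBinaryMatroid {n : ℕ} (S : Set (Fin n → ℝ)) : Prop :=
  ∃ M : Matroid (Fin n), M.E = Set.univ ∧
    S = {x | ∃ B : Set (Fin n), M.IsBase B ∧ x = B.indicator (fun _ => (1 : ℝ))}

/-- A matrix all of whose entries lie in `{0,1}`. -/
def IsBinaryMatrix {d n : ℕ} (W : Matrix (Fin d) (Fin n) ℝ) : Prop :=
  ∀ i j, W i j = 0 ∨ W i j = 1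

/-- The projection polytope `conv(WS) = conv {W x : x ∈ S}` in `ℝᵈ`. -/
def projectionPolytope {d n : ℕ} (W : Matrix (Fin d) (Fin n) ℝ) (S : Set (Fin n → ℝ)) :
    Set (Fin d → ℝ) :=
  convexHull ℝ ((fun x => W.mulVec x) '' S)

/-- The vertices of a polytope are its extreme points. -/
def polytopeVertices {d : ℕ} (P : Set (Fin d → ℝ)) : Set (Fin d → ℝ) :=
  P.extremePoints ℝ

/-- The projection of a matroid has finitely many vertices, so that counting them with
`Set.ncard` is meaningful. -/
theorem finite_vertices_of_isBinaryMatroid {d n : ℕ} (W : Matrix (Fin d) (Fin n) ℝ)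
    (S : Set (Fin n → ℝ)) (hS : IsBinaryMatroid S) :
    (polytopeVertices (projectionPolytope W S)).Finite := by
  obtain ⟨M, -, rfl⟩ := hS
  refine Set.Finite.subset (Set.Finite.image _ ?_) extremePoints_convexHull_subset
  refine (Set.finite_range
    (fun B : Set (Fin n) => B.indicator (fun _ => (1 : ℝ)))).subset ?_
  rintro x ⟨B, -, rfl⟩
  exact ⟨B, rfl⟩

/-- The numbers of vertices of `conv(WS)`, over all `n`, all matroids `S ⊆ {0,1}ⁿ`, and all
`{0,1}`-valued `d × n` matrices `W`. -/
def projectionVertexCounts (d : ℕ) : Set ℕ :=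
  {v | ∃ (n : ℕ) (S : Set (Fin n → ℝ)) (W : Matrix (Fin d) (Fin n) ℝ),
    IsBinaryMatroid S ∧ IsBinaryMatrix W ∧
      v = (polytopeVertices (projectionPolytope W S)).ncard}

/-- `m(d)`, the maximum number of vertices of `conv(WS)` over matroids `S` and binary `d × n`
matrices `W`. (That the supremum is attained is asserted in the theorem about it.) -/
noncomputable def maxProjectionVertices (d : ℕ) : ℕ :=
  sSup (projectionVertexCounts d)

/-- The upper bound `2 ∑_{k=0}^{d-1} C((3^d - 3)/2, k)`; for `d ≥ 1` the number `3^d - 3` is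
nonnegative and even, so the natural-number operations are exact. -/
def projectionVertexBound (d : ℕ) : ℕ :=
  2 * ∑ k ∈ Finset.range d, Nat.choose ((3 ^ d - 3) / 2) k

/-! Upper bound: a vertex of the projection is the unique maximiser of some generic functional `c`,
and a base has maximal weight as soon as no single exchange improves it. An exchange moves the
projected point by a difference of two columns of `W`, a vector of `{-1,0,1}ᵈ`, so the signs of `c`
on these vectors determine the vertex (`basePoint_eq_of_forall_sign`). Up to sign there are `(3^d -
1)/2` nonzero ones. On either side of the hyperplane of one of them, the remaining `(3^d - 3)/2`
realise at most `∑_{k<d} C((3^d - 3)/2, k)` sign patterns by Sauer–Shelah (`card_image_sign_le`).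

Lower bound: for a partition matroid the projection is a Minkowski sum of blocks. Take the cube
together with, for each vertex `v`, the hull of its other vertices. A functional that ranks `v`
first and its neighbour in direction `i` second picks that neighbour in the block missing `v` and
`v` in all others. The `d * 2^d` resulting sums are distinct vertices. -/

/-! ### Local optimality of bases -/

namespace Matroid

/-- Symmetric basis exchange. -/
theorem IsBase.exists_symmetric_exchange {α : Type*} {M : Matroid α} {B B' : Set α} {e : α}
    (hB : M.IsBase B) (hB' : M.IsBase B') (he : e ∈ B') (heB : e ∉ B) :
    ∃ f ∈ B, f ∉ B' ∧ M.IsBase (insert e (B \ {f})) ∧ M.IsBase (insert f (B' \ {e})) := by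
  have heE : e ∈ M.E := hB'.subset_ground he
  have hC := hB.fundCircuit_isCircuit heE heB
  -- A circuit and a cocircuit never meet in exactly one element, so a second common element `f`
  -- exists.
  have hne := hC.inter_isCocircuit_ne_singleton (fundCocircuit_isCocircuit he hB') (e := e)
  have hmem : e ∈ M.fundCircuit e B ∩ M.fundCocircuit e B' :=
    ⟨M.mem_fundCircuit e B, M.mem_fundCocircuit e B'⟩
  obtain ⟨f, ⟨hfC, hfK⟩, hfe⟩ : ∃ f ∈ M.fundCircuit e B ∩ M.fundCocircuit e B', f ≠ e := by
    by_contra! h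
    exact hne (Set.eq_singleton_iff_unique_mem.2 ⟨hmem, h⟩)
  have hfB : f ∈ B := by
    have := M.fundCircuit_subset_insert e B hfC
    simpa [hfe] using this
  have hfB' : f ∉ B' := by
    have := M.fundCocircuit_subset_insert_compl e B' hfK
    simp only [Set.mem_insert_iff, hfe, false_or] at this
    exact this.2
  refine ⟨f, hfB, hfB', ?_, ?_⟩
  · rw [hB.indep.mem_fundCircuit_iff (by rwa [hB.closure_eq]) heB] at hfC
    have := hB.exchange_isBase_of_indep' hfB heB hfC
    rwa [← Set.insert_sdiff_singleton_comm (Ne.symm hfe)] at this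
  · rw [hB'.mem_fundCocircuit_iff_mem_fundCircuit,
      hB'.indep.mem_fundCircuit_iff (by rw [hB'.closure_eq]; exact hB.subset_ground hfB) hfB'] at hfK
    have := hB'.exchange_isBase_of_indep' he hfB' hfK
    rwa [← Set.insert_sdiff_singleton_comm hfe] at this

end Matroid

theorem sum_indicator_insert_sdiff_singleton {α : Type*} [Fintype α] (w : α → ℝ) {B : Set α}
    {e f : α} (he : e ∉ B) (hf : f ∈ B) :
    ∑ i, (insert e (B \ {f})).indicator w i = ∑ i, B.indicator w i + w e - w f := by
  classical
  have h : ∀ i, (insert e (B \ {f})).indicator w i =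
      B.indicator w i + (if i = e then w e else 0) - (if i = f then w f else 0) := by
    intro i
    have hef : e ≠ f := fun h => he (h ▸ hf)
    by_cases hie : i = e
    · subst hie; simp [he, hef]
    · by_cases hif : i = f
      · subst hif; simp [hf, hie]
      · by_cases hi : i ∈ B <;> simp [hi, hie, hif]
  simp [h, Finset.sum_add_distrib, Finset.sum_sub_distrib]

/-- A base whose weight no single exchange increases has maximum weight. -/
theorem Matroid.IsBase.sum_indicator_le_of_forall_exchange {α : Type*} [Fintype α]
    {M : Matroid α} {B : Set α} (w : α → ℝ) (hB : M.IsBase B)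
    (hloc : ∀ e f, f ∈ B → e ∉ B → M.IsBase (insert e (B \ {f})) → w e ≤ w f)
    {B' : Set α} (hB' : M.IsBase B') :
    ∑ i, B'.indicator w i ≤ ∑ i, B.indicator w i := by
  induction hk : (B' \ B).ncard using Nat.strong_induction_on generalizing B' with
  | _ k ih =>
    by_cases hsub : B' ⊆ B
    · rw [hB'.eq_of_subset_isBase hB hsub]
    · obtain ⟨e, he, heB⟩ := Set.not_subset.1 hsub
      -- One exchange does both jobs: `h1` makes local optimality applicable, giving `w e ≤ w f`, so
      -- the base in `h2` is nearer to `B` and weighs at least as much as `B'`.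
      obtain ⟨f, hf, hfB', h1, h2⟩ := hB.exists_symmetric_exchange hB' he heB
      have hlt : (insert f (B' \ {e}) \ B).ncard < k := by
        rw [← hk]
        refine Set.ncard_lt_ncard ⟨?_, ?_⟩ (Set.toFinite _)
        · rintro x ⟨rfl | hx, hxB⟩
          · exact absurd hf hxB
          · exact ⟨hx.1, hxB⟩
        · intro h
          obtain ⟨rfl | hx, -⟩ := h ⟨he, heB⟩
          · exact hfB' he
          · exact hx.2 rfl
      have h3 := ih _ hlt h2 rfl
      rw [sum_indicator_insert_sdiff_singleton w hfB' he] at h3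
      linarith [hloc e f hf heB h1]

/-! ### Counting sign patterns and generic functionals -/

/-- The regions of a central arrangement in `ℝᵈ` on one side of one of its hyperplanes. -/
theorem card_image_sign_le {ι : Type*} [Fintype ι] [DecidableEq ι] {d : ℕ}
    (g₀ : Fin d → ℝ) (g : ι → Fin d → ℝ) (C : Finset (Fin d → ℝ))
    (h₀ : ∀ c ∈ C, 0 < g₀ ⬝ᵥ c) (hne : ∀ c ∈ C, ∀ i, g i ⬝ᵥ c ≠ 0) :
    (C.image fun c => Finset.univ.filter fun i => 0 < g i ⬝ᵥ c).card ≤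
      ∑ k ∈ Finset.range d, (Fintype.card ι).choose k := by
  rcases C.eq_empty_or_nonempty with rfl | ⟨c, hc⟩
  · simp
  set 𝒜 := C.image fun c => Finset.univ.filter fun i => 0 < g i ⬝ᵥ c
  have hvc : ∀ s, 𝒜.Shatters s → s.card < d := by
    intro s hs
    by_contra! hd
    let v : Option s → Fin d → ℝ := fun o => o.elim g₀ fun i => g i
    have hdep : ¬ LinearIndependent ℝ v := by
      intro hli
      have := hli.fintype_card_le_finrank
      simp at this
      omega
    obtain ⟨a, ha, o, hao⟩ := Fintype.not_linearIndependent_iff.1 hdep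
    wlog hpos : 0 ≤ a none generalizing a
    · refine this (-a) ?_ (by simpa using hao) (by simp; linarith)
      simp [Finset.sum_neg_distrib, ha]
    -- Shattering supplies a `c` whose signs match the dependence coefficients; pairing the
    -- dependence with `c` then gives a vanishing sum of nonnegative terms, one of them nonzero.
    obtain ⟨u, hu, hsu⟩ := @hs (s.filter fun i => ∃ h : i ∈ s, 0 < a (some ⟨i, h⟩))
      (Finset.filter_subset _ _)
    obtain ⟨c, hc, rfl⟩ := Finset.mem_image.1 hu
    have hsign : ∀ i : s, 0 < g i ⬝ᵥ c ↔ 0 < a (some i) := by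
      intro i
      have := Finset.ext_iff.1 hsu i
      simpa using this
    have hsum : ∑ o, a o * (v o ⬝ᵥ c) = 0 := by
      have := congrArg (· ⬝ᵥ c) ha
      simpa [sum_dotProduct, smul_dotProduct] using this
    have hnn : ∀ o ∈ Finset.univ, 0 ≤ a o * (v o ⬝ᵥ c) := by
      rintro (_ | i) -
      · exact mul_nonneg hpos (h₀ c hc).le
      · rcases lt_or_ge 0 (a (some i)) with h | h
        · exact mul_nonneg h.le ((hsign i).2 h).le
        · exact mul_nonneg_of_nonpos_of_nonpos h
            (not_lt.1 fun h' => h.not_gt ((hsign i).1 h'))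
    have hz := (Finset.sum_eq_zero_iff_of_nonneg hnn).1 hsum o (Finset.mem_univ _)
    rcases mul_eq_zero.1 hz with h | h
    · exact hao h
    · cases o with
      | none => exact (h₀ c hc).ne' h
      | some i => exact hne c hc i h
  refine (𝒜.card_le_card_shatterer.trans Finset.card_shatterer_le_sum_vcDim).trans ?_
  refine Finset.sum_le_sum_of_subset fun k hk => ?_
  have hd : 0 < d := by
    rcases d with _ | d
    · simpa using h₀ c hc
    · omega
  have : 𝒜.vcDim < d := (Finset.sup_lt_iff hd).2 fun s hs => hvc s (Finset.mem_shatterer.1 hs)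
  simp at hk ⊢
  omega

/-- The nonzero vectors of `{-1,0,1}ᵈ`, up to sign. -/
theorem exists_half_system (d : ℕ) (hd : 1 ≤ d) :
    ∃ (g₀ : Fin d → SignType) (H : Finset (Fin d → SignType)), g₀ ≠ 0 ∧ 0 ∉ H ∧
      H.card = (3 ^ d - 3) / 2 ∧
      ∀ g : Fin d → SignType, g ≠ 0 → g = g₀ ∨ g = -g₀ ∨ g ∈ H ∨ -g ∈ H := by
  classical
  let T : (Fin d → SignType) → Fin d → ℝ := fun g i => (g i : ℝ)
  have hT0 : ∀ g, g ≠ 0 → T g ≠ 0 := by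
    intro g hg h
    apply hg
    funext i
    have := congrFun h i
    simp only [T] at this
    cases hgi : g i <;> simp [hgi] at this ⊢
  have hTneg : ∀ g, T (-g) = - T g := by
    intro g
    funext i
    simp only [T, Pi.neg_apply]
    cases hgi : g i <;> simp
  -- A functional vanishing at none of the nonzero vectors selects one from each pair `±g`.
  obtain ⟨u, hu⟩ := Module.exists_dual_forall_apply_ne_zero (K := ℝ)
    (fun g : {g : Fin d → SignType // g ≠ 0} => T g) (fun g => hT0 g g.2)
  let P := Finset.univ.filter fun g => 0 < u (T g)
  let N := Finset.univ.filter fun g => u (T g) < 0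
  have hPN : N.card = P.card := by
    refine Finset.card_bij (fun g _ => -g) ?_ ?_ ?_
    · intro g hg
      simpa [P, N, hTneg] using hg
    · intro a _ b _ h
      simpa using h
    · intro b hb
      exact ⟨-b, by simpa [P, N, hTneg] using hb, by simp⟩
  have hT00 : T 0 = 0 := by funext i; simp [T]
  have htot : 1 + P.card + N.card = 3 ^ d := by
    have h3 : (Finset.univ : Finset (Fin d → SignType)).card = 3 ^ d := by
      rw [Finset.card_univ, Fintype.card_fun, Fintype.card_fin]; rfl
    rw [← h3]
    have hdec : (Finset.univ : Finset (Fin d → SignType)) = insert 0 (P ∪ N) := by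
      ext g
      by_cases hg : g = 0
      · simp [hg]
      · have := hu ⟨g, hg⟩
        simp only [Finset.mem_univ, Finset.mem_insert, Finset.mem_union, true_iff, P, N,
          Finset.mem_filter, true_and]
        exact Or.inr (lt_or_gt_of_ne this).symm
    rw [hdec, Finset.card_insert_of_notMem (by simp [P, N, hT00]), Finset.card_union_of_disjoint]
    · omega
    · rw [Finset.disjoint_left]
      intro g hg hg'
      simp only [P, N, Finset.mem_filter] at hg hg'
      linarith [hg.2, hg'.2]
  have h3d : 3 ≤ 3 ^ d := by
    calc 3 = 3 ^ 1 := rfl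
      _ ≤ 3 ^ d := Nat.pow_le_pow_right (by norm_num) hd
  obtain ⟨g₀, hg₀⟩ : P.Nonempty := by
    rw [← Finset.card_pos]; omega
  have hP0 : 0 ∉ P := by simp [P, hT00]
  refine ⟨g₀, P.erase g₀, fun h => hP0 (h ▸ hg₀), fun h => hP0 (Finset.mem_of_mem_erase h), ?_, ?_⟩
  · rw [Finset.card_erase_of_mem hg₀]; omega
  · intro g hg
    by_cases h1 : g = g₀
    · exact Or.inl h1
    by_cases h2 : g = -g₀
    · exact Or.inr (Or.inl h2)
    have h2' : -g ≠ g₀ := fun h => h2 (by rw [← h, neg_neg])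
    right; right
    simp only [Finset.mem_erase, ne_eq, h1, h2', not_false_eq_true, true_and]
    simp only [P, Finset.mem_filter, Finset.mem_univ, true_and, hTneg, map_neg]
    rcases lt_or_gt_of_ne (hu ⟨g, hg⟩) with h | h
    · right; simpa using h
    · left; exact h

/-- An extreme point of the convex hull of a finite set is the unique maximiser of a functional
which is nonzero at finitely many prescribed nonzero vectors. -/
theorem exists_generic_dotProduct_lt {d : ℕ} {F : Set (Fin d → ℝ)} (hF : F.Finite)
    {x : Fin d → ℝ} (hx : x ∈ (convexHull ℝ F).extremePoints ℝ)
    {ι : Type*} [Finite ι] (g : ι → Fin d → ℝ) (hg : ∀ i, g i ≠ 0) :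
    ∃ c : Fin d → ℝ, (∀ y ∈ F, y ≠ x → y ⬝ᵥ c < x ⬝ᵥ c) ∧ ∀ i, g i ⬝ᵥ c ≠ 0 := by
  have hvec : ∀ f : (Fin d → ℝ) →ₗ[ℝ] ℝ, ∃ c : Fin d → ℝ, ∀ y, f y = y ⬝ᵥ c := fun f =>
    ⟨fun i => f (Pi.single i 1), fun y => by
      rw [LinearMap.pi_apply_eq_sum_univ f y]
      simp only [dotProduct, smul_eq_mul]
      refine Finset.sum_congr rfl fun i _ => ?_
      congr 2
      funext j
      simp [Pi.single_apply, eq_comm]⟩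
  have hnot : x ∉ convexHull ℝ (F \ {x}) := fun h =>
    ((convex_convexHull ℝ F).mem_extremePoints_iff_mem_sdiff_convexHull_sdiff.1 hx).2
      (convexHull_mono (Set.sdiff_subset_sdiff_left (subset_convexHull ℝ F)) h)
  obtain ⟨f, r, hf, hr⟩ := geometric_hahn_banach_closed_point (convex_convexHull ℝ (F \ {x}))
    ((hF.sdiff (t := {x})).isClosed_convexHull ℝ) hnot
  obtain ⟨c, hc⟩ := hvec f
  obtain ⟨u', hu'⟩ := Module.exists_dual_forall_apply_ne_zero (K := ℝ) g hg
  obtain ⟨u, hu⟩ := hvec u'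
  -- The strict inequalities survive small perturbations, and moving along `u` with `ε ≠ 0` leaves
  -- every hyperplane `g i ⬝ᵥ c = 0`.
  have hcont : ∀ z : Fin d → ℝ, Continuous fun ε : ℝ => z ⬝ᵥ (c + ε • u) := by
    intro z
    simp only [dotProduct_add, dotProduct_smul]
    fun_prop
  have h1 : ∀ᶠ ε in nhdsWithin (0 : ℝ) {0}ᶜ,
      ∀ y ∈ F \ {x}, y ⬝ᵥ (c + ε • u) < x ⬝ᵥ (c + ε • u) := by
    rw [eventually_all_finite hF.sdiff]
    intro y hy
    refine nhdsWithin_le_nhds (((hcont y).continuousAt).eventually_lt (hcont x).continuousAt ?_)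
    have := (hf y (subset_convexHull ℝ _ hy)).trans hr
    simpa [← hc] using this
  have h2 : ∀ᶠ ε in nhdsWithin (0 : ℝ) {0}ᶜ, ∀ i, g i ⬝ᵥ (c + ε • u) ≠ 0 := by
    rw [eventually_all]
    intro i
    by_cases h : g i ⬝ᵥ c = 0
    · filter_upwards [self_mem_nhdsWithin] with ε hε
      simp only [dotProduct_add, dotProduct_smul, h, zero_add, smul_eq_mul]
      exact mul_ne_zero hε (by rw [← hu]; exact hu' i)
    · refine nhdsWithin_le_nhds ((hcont (g i)).continuousAt.eventually_ne ?_)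
      simpa using h
  obtain ⟨ε, hε1, hε2⟩ := (h1.and h2).exists
  exact ⟨c + ε • u, fun y hy hyx => hε1 y ⟨hy, hyx⟩, hε2⟩

/-! ### The upper bound -/

/-- The real vector with the given entries in `{-1,0,1}`. -/
def signVector {d : ℕ} (g : Fin d → SignType) : Fin d → ℝ := fun i => (g i : ℝ)

theorem signVector_neg {d : ℕ} (g : Fin d → SignType) : signVector (-g) = -signVector g := by
  funext i
  simp only [signVector, Pi.neg_apply]
  cases g i <;> simp

theorem signVector_ne_zero {d : ℕ} {g : Fin d → SignType} (hg : g ≠ 0) : signVector g ≠ 0 := by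
  intro h
  apply hg
  funext i
  have := congrFun h i
  simp only [signVector] at this
  cases hgi : g i <;> simp [hgi] at this ⊢

theorem signVector_zero {d : ℕ} : signVector (0 : Fin d → SignType) = 0 := by
  funext i
  simp [signVector]

/-- The image of a base under a matrix. -/
noncomputable def basePoint {d n : ℕ} (W : Matrix (Fin d) (Fin n) ℝ) (B : Set (Fin n)) :
    Fin d → ℝ :=
  W.mulVec (B.indicator fun _ => 1)

theorem basePoint_dotProduct {d n : ℕ} (W : Matrix (Fin d) (Fin n) ℝ) (B : Set (Fin n))
    (c : Fin d → ℝ) :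
    basePoint W B ⬝ᵥ c = ∑ i, B.indicator (fun i => W.col i ⬝ᵥ c) i := by
  classical
  simp only [basePoint, Matrix.mulVec, dotProduct, Finset.sum_mul]
  rw [Finset.sum_comm]
  refine Finset.sum_congr rfl fun i _ => ?_
  by_cases hi : i ∈ B <;> simp [hi, Matrix.col]

theorem exists_signVector_eq_col_sub {d n : ℕ} {W : Matrix (Fin d) (Fin n) ℝ}
    (hW : IsBinaryMatrix W) (e f : Fin n) :
    ∃ g : Fin d → SignType, signVector g = W.col e - W.col f := by
  refine ⟨fun i => SignType.sign (W i e - W i f), ?_⟩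
  funext i
  rcases hW i e with h | h <;> rcases hW i f with h' | h' <;> simp [signVector, Matrix.col, h, h']

/-- The signs of a functional on `{-1,0,1}ᵈ` determine where it is maximal. -/
theorem basePoint_eq_of_forall_sign {d n : ℕ} {W : Matrix (Fin d) (Fin n) ℝ}
    (hW : IsBinaryMatrix W) {M : Matroid (Fin n)} {B B' : Set (Fin n)} (hB : M.IsBase B)
    (hB' : M.IsBase B') {c c' : Fin d → ℝ}
    (hc : ∀ A, M.IsBase A → basePoint W A ≠ basePoint W B →
      basePoint W A ⬝ᵥ c < basePoint W B ⬝ᵥ c)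
    (hc' : ∀ A, M.IsBase A → basePoint W A ≠ basePoint W B' →
      basePoint W A ⬝ᵥ c' < basePoint W B' ⬝ᵥ c')
    (hs : ∀ g : Fin d → SignType, g ≠ 0 → 0 < signVector g ⬝ᵥ c' → 0 < signVector g ⬝ᵥ c) :
    basePoint W B = basePoint W B' := by
  by_contra hne
  refine (hc' B hB hne).not_ge ?_
  simp only [basePoint_dotProduct]
  refine hB.sum_indicator_le_of_forall_exchange _ (fun e f hf he hex => ?_) hB'
  by_contra! hlt
  obtain ⟨g, hg⟩ := exists_signVector_eq_col_sub hW e f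
  have hpos : 0 < signVector g ⬝ᵥ c' := by rw [hg, sub_dotProduct]; linarith
  have hg0 : g ≠ 0 := by
    rintro rfl
    simp [signVector_zero] at hpos
  have h1 := hs g hg0 hpos
  rw [hg, sub_dotProduct] at h1
  have h2 : basePoint W (insert e (B \ {f})) ⬝ᵥ c ≤ basePoint W B ⬝ᵥ c := by
    by_cases h : basePoint W (insert e (B \ {f})) = basePoint W B
    · rw [h]
    · exact (hc _ hex h).le
  rw [basePoint_dotProduct, basePoint_dotProduct, sum_indicator_insert_sdiff_singleton _ he hf] at h2
  linarith

theorem ncard_vertices_le {d n : ℕ} (hd : 1 ≤ d) {S : Set (Fin n → ℝ)}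
    {W : Matrix (Fin d) (Fin n) ℝ} (hS : IsBinaryMatroid S) (hW : IsBinaryMatrix W) :
    (polytopeVertices (projectionPolytope W S)).ncard ≤ projectionVertexBound d := by
  classical
  have hfin := finite_vertices_of_isBinaryMatroid W S hS
  obtain ⟨M, -, rfl⟩ := hS
  set F := (fun x => W.mulVec x) ''
    {x | ∃ B : Set (Fin n), M.IsBase B ∧ x = B.indicator (fun _ => (1 : ℝ))} with hFdef
  have hF : ∀ y, y ∈ F ↔ ∃ B, M.IsBase B ∧ basePoint W B = y := by
    intro y
    constructor
    · rintro ⟨_, ⟨B, hB, rfl⟩, rfl⟩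
      exact ⟨B, hB, rfl⟩
    · rintro ⟨B, hB, rfl⟩
      exact ⟨_, ⟨B, hB, rfl⟩, rfl⟩
  have hFfin : F.Finite :=
    (Set.finite_range (basePoint W)).subset fun y hy =>
      let ⟨B, _, h⟩ := (hF y).1 hy
      ⟨B, h⟩
  have hex : ∀ x ∈ polytopeVertices (projectionPolytope W _), ∃ c : Fin d → ℝ,
      (∀ y ∈ F, y ≠ x → y ⬝ᵥ c < x ⬝ᵥ c) ∧
        ∀ g : {g : Fin d → SignType // g ≠ 0}, signVector g.1 ⬝ᵥ c ≠ 0 :=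
    fun x hx => exists_generic_dotProduct_lt hFfin hx _ fun g => signVector_ne_zero g.2
  choose! c hc hcg using hex
  obtain ⟨g₀, H, hg₀, hH0, hHcard, hH⟩ := exists_half_system d hd
  set V := hfin.toFinset with hV
  have hVmem : ∀ x, x ∈ V → x ∈ polytopeVertices (projectionPolytope W _) := fun x hx =>
    hfin.mem_toFinset.1 hx
  have key : ∀ h : Fin d → SignType, (h = g₀ ∨ h = -g₀) →
      (V.filter fun x => 0 < signVector h ⬝ᵥ c x).card ≤
        ∑ k ∈ Finset.range d, ((3 ^ d - 3) / 2).choose k := by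
    intro h hh
    set U := V.filter fun x => 0 < signVector h ⬝ᵥ c x with hU
    have hUmem : ∀ x ∈ U, x ∈ V ∧ 0 < signVector h ⬝ᵥ c x := fun x hx => Finset.mem_filter.1 hx
    have hle := card_image_sign_le (signVector h) (fun i : H => signVector i.1) (U.image c)
      (by
        intro y hy
        obtain ⟨x, hx, rfl⟩ := Finset.mem_image.1 hy
        exact (hUmem x hx).2)
      (by
        intro y hy i
        obtain ⟨x, hx, rfl⟩ := Finset.mem_image.1 hy
        exact hcg x (hVmem x (hUmem x hx).1) ⟨i.1, fun h0 => hH0 (h0 ▸ i.2)⟩)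
    rw [Fintype.card_coe, hHcard, Finset.image_image, Finset.card_image_of_injOn] at hle
    · exact hle
    -- Both functionals lie on the same side of `g₀`, so equal patterns on `H` give equal signs on
    -- all of `{-1,0,1}ᵈ`.
    intro x hx y hy hxy
    obtain ⟨hxV, hx0⟩ := hUmem x hx
    obtain ⟨hyV, hy0⟩ := hUmem y hy
    have hsH : ∀ g ∈ H, 0 < signVector g ⬝ᵥ c x ↔ 0 < signVector g ⬝ᵥ c y := by
      intro g hg
      have := Finset.ext_iff.1 hxy ⟨g, hg⟩
      simpa using this
    have hs : ∀ g : Fin d → SignType, g ≠ 0 → 0 < signVector g ⬝ᵥ c y →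
        0 < signVector g ⬝ᵥ c x := by
      intro g hg hgy
      have hcase : g = h ∨ g = -h ∨ g ∈ H ∨ -g ∈ H := by
        rcases hh with rfl | rfl
        · exact hH g hg
        · rw [neg_neg]
          have := hH g hg
          tauto
      rcases hcase with rfl | rfl | hgH | hgH
      · exact hx0
      · rw [signVector_neg, neg_dotProduct] at hgy
        linarith
      · exact (hsH g hgH).2 hgy
      · have h1 := hsH _ hgH
        have h2 := hcg x (hVmem x hxV) ⟨g, hg⟩
        rw [signVector_neg, neg_dotProduct, neg_dotProduct] at h1
        by_contra hn
        have h3 : signVector g ⬝ᵥ c x < 0 := lt_of_le_of_ne (not_lt.1 hn) h2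
        linarith [h1.1 (by linarith)]
    obtain ⟨B, hB, rfl⟩ := (hF x).1 (extremePoints_convexHull_subset (hVmem x hxV))
    obtain ⟨B', hB', rfl⟩ := (hF y).1 (extremePoints_convexHull_subset (hVmem y hyV))
    exact basePoint_eq_of_forall_sign hW hB hB'
      (fun A hA => hc _ (hVmem _ hxV) _ ((hF _).2 ⟨A, hA, rfl⟩))
      (fun A hA => hc _ (hVmem _ hyV) _ ((hF _).2 ⟨A, hA, rfl⟩)) hs
  have hcover : V ⊆ (V.filter fun x => 0 < signVector g₀ ⬝ᵥ c x) ∪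
      V.filter fun x => 0 < signVector (-g₀) ⬝ᵥ c x := by
    intro x hx
    have := hcg x (hVmem x hx) ⟨g₀, hg₀⟩
    simp only [Finset.mem_union, Finset.mem_filter, hx, true_and, signVector_neg, neg_dotProduct,
      Left.neg_pos_iff]
    exact (lt_or_gt_of_ne this).symm
  rw [Set.ncard_eq_toFinset_card _ hfin]
  calc V.card ≤ _ := Finset.card_le_card hcover
    _ ≤ _ := Finset.card_union_le _ _
    _ ≤ _ := add_le_add (key _ (Or.inl rfl)) (key _ (Or.inr rfl))
    _ = projectionVertexBound d := by rw [projectionVertexBound, two_mul]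

/-! ### The lower bound -/

theorem mem_extremePoints_convexHull_of_forall_lt {d : ℕ} {F : Set (Fin d → ℝ)} {x : Fin d → ℝ}
    (hx : x ∈ F) (c : Fin d → ℝ) (hc : ∀ y ∈ F, y ≠ x → y ⬝ᵥ c < x ⬝ᵥ c) :
    x ∈ (convexHull ℝ F).extremePoints ℝ := by
  have hsub : convexHull ℝ F ⊆ {y | y ⬝ᵥ c ≤ x ⬝ᵥ c ∧ (y ⬝ᵥ c = x ⬝ᵥ c → y = x)} := by
    refine convexHull_min (fun y hy => ?_) ?_
    · by_cases h : y = x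
      · simp [h]
      · exact ⟨(hc y hy h).le, fun h' => absurd h' (hc y hy h).ne⟩
    · rw [convex_iff_forall_pos]
      rintro y ⟨hy, hy'⟩ z ⟨hz, hz'⟩ a b ha hb hab
      have hb' : b = 1 - a := by linarith
      subst hb'
      simp only [Set.mem_ofPred_eq, add_dotProduct, smul_dotProduct, smul_eq_mul]
      constructor
      · nlinarith
      · intro h
        have h1 : y = x := hy' (by nlinarith)
        have h2 : z = x := hz' (by nlinarith)
        rw [h1, h2, ← add_smul, hab, one_smul]
  refine mem_extremePoints_iff_left.2 ⟨subset_convexHull ℝ F hx, fun y hy z hz hxyz => ?_⟩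
  obtain ⟨hy1, hy2⟩ := hsub hy
  obtain ⟨hz1, -⟩ := hsub hz
  obtain ⟨a, b, ha, hb, hab, h⟩ := hxyz
  apply hy2
  have := congrArg (· ⬝ᵥ c) h
  simp only [add_dotProduct, smul_dotProduct, smul_eq_mul] at this
  have hb' : b = 1 - a := by linarith
  subst hb'
  nlinarith

/-- The partition matroid on `α × β` whose bases are the graphs of the functions `α → β`. -/
def graphMatroid {n : ℕ} {α β : Type*} [DecidableEq α] [Nonempty β] (e : Fin n ≃ α × β) :
    Matroid (Fin n) :=
  Matroid.ofIsBaseOfFinite (E := Set.univ) Set.finite_univ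
    (fun B => ∃ f : α → β, B = {k | (e k).2 = f (e k).1})
    ⟨_, fun _ => Classical.arbitrary β, rfl⟩
    (by
      rintro _ _ ⟨f, rfl⟩ ⟨g, rfl⟩ k ⟨hkf, hkg⟩
      simp only [Set.mem_ofPred_eq] at hkf hkg
      refine ⟨e.symm ((e k).1, g (e k).1), ⟨by simp, ?_⟩,
        Function.update f (e k).1 (g (e k).1), ?_⟩
      · simp only [Set.mem_ofPred_eq, Equiv.apply_symm_apply]
        rw [← hkf]
        exact fun h => hkg h.symm
      · ext l
        simp only [Set.mem_insert_iff, Set.mem_sdiff, Set.mem_ofPred_eq, Set.mem_singleton_iff,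
          Equiv.eq_symm_apply, Function.update_apply]
        by_cases h : (e l).1 = (e k).1
        · rw [if_pos h, h]
          constructor
          · rintro (h' | ⟨h1, h2⟩)
            · rw [h']
            · exact absurd (e.injective (Prod.ext h (by rw [h1, hkf]))) h2
          · exact fun h' => Or.inl (Prod.ext h h')
        · rw [if_neg h]
          constructor
          · rintro (h' | ⟨h1, -⟩)
            · exact absurd (by rw [h']) h
            · exact h1
          · exact fun h' => Or.inr ⟨h', fun hlk => h (by rw [hlk])⟩)
    (fun _ _ => Set.subset_univ _)

theorem sum_indicator_graph {n : ℕ} {α β : Type*} [Fintype α] [Fintype β]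
    (e : Fin n ≃ α × β) (f : α → β) (w : α × β → ℝ) :
    ∑ k, {k | (e k).2 = f (e k).1}.indicator (fun k => w (e k)) k = ∑ a, w (a, f a) := by
  classical
  have : ∀ k, {k | (e k).2 = f (e k).1}.indicator (fun k => w (e k)) k =
      (fun q : α × β => if q.2 = f q.1 then w q else 0) (e k) := by
    intro k
    simp [Set.indicator_apply]
  simp_rw [this]
  rw [e.sum_comp fun q : α × β => if q.2 = f q.1 then w q else 0, Fintype.sum_prod_type]
  simp

/-- The vertex of the cube `[0,1]ᵈ` with the given coordinates. -/
def cubeVertex {d : ℕ} (v : Fin d → Bool) : Fin d → ℝ := fun j => if v j then 1 else 0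

/-- Block `none` runs through all vertices of the cube, block `some v` through all but `v`. -/
def blockVertex {d : ℕ} (q : Option (Fin d → Bool) × (Fin d → Bool)) : Fin d → Bool :=
  -- Using the antipode in place of `v` keeps all blocks the same size, so the ground set is a
  -- product.
  if q.1 = some q.2 then fun j => !q.2 j else q.2

/-- The vertex of block `a` maximising the functional `cubeFunctional v i`. -/
def bestVertex {d : ℕ} (v : Fin d → Bool) (i : Fin d) (a : Option (Fin d → Bool)) :
    Fin d → Bool :=
  if a = some v then Function.update v i (!v i) else v

/-- A functional maximal on the cube at `v` and, next, at the neighbour of `v` in direction `i`. -/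
def cubeFunctional {d : ℕ} (v : Fin d → Bool) (i : Fin d) : Fin d → ℝ :=
  fun j => (if v j then 1 else -1) * if j = i then 1 else 2

theorem cubeVertex_dotProduct_cubeFunctional {d : ℕ} (v w : Fin d → Bool) (i : Fin d) :
    cubeVertex w ⬝ᵥ cubeFunctional v i = cubeVertex v ⬝ᵥ cubeFunctional v i -
      ∑ j, if w j = v j then 0 else if j = i then (1 : ℝ) else 2 := by
  simp only [dotProduct, ← Finset.sum_sub_distrib]
  refine Finset.sum_congr rfl fun j _ => ?_
  by_cases hi : j = i <;> cases hw : w j <;> cases hv : v j <;>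
    simp [cubeVertex, cubeFunctional, hi, hw, hv] <;> simp_all

theorem blockVertex_ne {d : ℕ} (hd : 1 ≤ d) (v w : Fin d → Bool) :
    blockVertex (some v, w) ≠ v := by
  unfold blockVertex
  by_cases h : v = w
  · subst h
    intro h'
    have := congrFun h' ⟨0, hd⟩
    simp at this
  · simpa [h] using Ne.symm h

theorem blockVertex_bestVertex {d : ℕ} (v : Fin d → Bool) (i : Fin d)
    (a : Option (Fin d → Bool)) : blockVertex (a, bestVertex v i a) = bestVertex v i a := by
  unfold blockVertex
  rw [if_neg]
  unfold bestVertex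
  by_cases h : a = some v
  · subst h
    simp
  · simp [h]

/-- Relative to `v`, flipping coordinate `i` costs 1 and flipping any other costs 2. So once `v` is
excluded, the `i`-neighbour is the unique best choice. -/
theorem dotProduct_blockVertex_lt {d : ℕ} (hd : 1 ≤ d) (v : Fin d → Bool) (i : Fin d)
    (q : Option (Fin d → Bool) × (Fin d → Bool)) (hq : blockVertex q ≠ bestVertex v i q.1) :
    cubeVertex (blockVertex q) ⬝ᵥ cubeFunctional v i <
      cubeVertex (bestVertex v i q.1) ⬝ᵥ cubeFunctional v i := by
  obtain ⟨a, w⟩ := q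
  rw [cubeVertex_dotProduct_cubeFunctional v (blockVertex _),
    cubeVertex_dotProduct_cubeFunctional v (bestVertex _ _ _), sub_lt_sub_iff_left]
  have hnn : ∀ x : Fin d → Bool, ∀ j ∈ Finset.univ,
      0 ≤ if x j = v j then 0 else if j = i then (1 : ℝ) else 2 := by
    intro x j _
    split_ifs <;> norm_num
  by_cases ha : a = some v
  · subst ha
    simp only [bestVertex, if_true] at hq ⊢
    have hne := blockVertex_ne hd v w
    set x := blockVertex (some v, w)
    have h1 : (∑ j, if Function.update v i (!v i) j = v j then 0
        else if j = i then (1 : ℝ) else 2) = 1 := by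
      rw [Finset.sum_eq_single i]
      · simp
      · intro j _ hj
        simp [Function.update_of_ne hj]
      · simp
    rw [h1]
    obtain ⟨j, hji, hj⟩ : ∃ j, j ≠ i ∧ x j ≠ v j := by
      by_contra! h
      by_cases hi : x i = v i
      · exact hne (funext fun j => by
          by_cases hj : j = i
          · rw [hj, hi]
          · exact h j hj)
      · refine hq (funext fun j => ?_)
        by_cases hj : j = i
        · subst hj
          simpa using Bool.eq_not_of_ne hi
        · rw [Function.update_of_ne hj, h j hj]
    calc (1 : ℝ) < if x j = v j then 0 else if j = i then (1 : ℝ) else 2 := by simp [hj, hji]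
      _ ≤ _ := Finset.single_le_sum (hnn x) (Finset.mem_univ j)
  · simp only [bestVertex, ha, if_false] at hq ⊢
    obtain ⟨j, hj⟩ := Function.ne_iff.1 hq
    simp only [if_true, Finset.sum_const_zero]
    refine Finset.sum_pos' (hnn _) ⟨j, Finset.mem_univ j, ?_⟩
    rw [if_neg hj]
    split_ifs <;> norm_num

theorem sum_cubeVertex_bestVertex {d : ℕ} (v : Fin d → Bool) (i j : Fin d) :
    ∑ a, cubeVertex (bestVertex v i a) j =
      (2 ^ d + 1) * cubeVertex v j - if j = i then (if v i then 1 else -1) else 0 := by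
  rw [Fintype.sum_option, ← Finset.add_sum_erase _ _ (Finset.mem_univ v)]
  have h : ∀ w ∈ Finset.univ.erase v, cubeVertex (bestVertex v i (some w)) j = cubeVertex v j := by
    intro w hw
    simp [bestVertex, Finset.ne_of_mem_erase hw]
  rw [Finset.sum_congr rfl h, Finset.sum_const, Finset.card_erase_of_mem (Finset.mem_univ v),
    Finset.card_univ, Fintype.card_fun, Fintype.card_fin, Fintype.card_bool, nsmul_eq_mul,
    Nat.cast_sub Nat.one_le_two_pow]
  by_cases hj : j = i
  · subst hj
    cases hv : v j <;> simp [bestVertex, cubeVertex, hv]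
  · simp only [bestVertex, cubeVertex, if_true, hj, if_false, Function.update_of_ne hj]
    push_cast
    simp
    split_ifs <;> ring

/-- The sum is `(2^d + 1) v` shifted by a unit step in direction `i`. Two shifts differ by at most 2
per coordinate, less than `2^d + 1`, so `v` can be read off. For `d = 1` this needs the extra block
`none`. -/
theorem injective_sum_cubeVertex {d : ℕ} (hd : 1 ≤ d) :
    Function.Injective fun q : (Fin d → Bool) × Fin d =>
      ∑ a, cubeVertex (bestVertex q.1 q.2 a) := by
  rintro ⟨v, i⟩ ⟨v', i'⟩ h
  have hN : (2 : ℝ) ≤ 2 ^ d := by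
    calc (2 : ℝ) = 2 ^ 1 := by norm_num
      _ ≤ 2 ^ d := pow_le_pow_right₀ (by norm_num) hd
  have hj : ∀ j, (2 ^ d + 1) * cubeVertex v j - (if j = i then (if v i then (1 : ℝ) else -1) else 0)
      = (2 ^ d + 1) * cubeVertex v' j -
        if j = i' then (if v' i' then 1 else -1) else 0 := by
    intro j
    have := congrFun h j
    simpa only [Finset.sum_apply, sum_cubeVertex_bestVertex] using this
  have hb : ∀ (x : Fin d → Bool) (k j : Fin d),
      |if j = k then (if x k then (1 : ℝ) else -1) else 0| ≤ 1 := by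
    intro x k j
    split_ifs <;> norm_num
  have hv : v = v' := by
    funext j
    have h1 := hj j
    have h2 := abs_le.1 (hb v i j)
    have h3 := abs_le.1 (hb v' i' j)
    cases h4 : v j <;> cases h5 : v' j <;> simp only [cubeVertex, h4, h5] at h1 ⊢ <;>
      norm_num at h1 <;> linarith
  subst hv
  have h1 := hj i
  by_cases hi : i = i'
  · rw [hi]
  · rw [if_pos rfl, if_neg hi] at h1
    split_ifs at h1 <;> linarith

theorem exists_le_projectionVertexCounts {d : ℕ} (hd : 1 ≤ d) :
    ∃ m ∈ projectionVertexCounts d, d * 2 ^ d ≤ m := by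
  classical
  let e := (Fintype.equivFin (Option (Fin d → Bool) × (Fin d → Bool))).symm
  let M := graphMatroid e
  let W : Matrix (Fin d) (Fin _) ℝ := Matrix.of fun j k => cubeVertex (blockVertex (e k)) j
  let S : Set (Fin _ → ℝ) :=
    {x | ∃ B : Set (Fin _), M.IsBase B ∧ x = B.indicator (fun _ => (1 : ℝ))}
  have hS : IsBinaryMatroid S := ⟨M, rfl, rfl⟩
  have hW : IsBinaryMatrix W := by
    intro j k
    simp only [W, Matrix.of_apply, cubeVertex]
    split_ifs <;> simp
  refine ⟨_, ⟨_, S, W, hS, hW, rfl⟩, ?_⟩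
  have hpt : ∀ f : Option (Fin d → Bool) → Fin d → Bool,
      basePoint W {k | (e k).2 = f (e k).1} = ∑ a, cubeVertex (blockVertex (a, f a)) := by
    intro f
    funext j
    rw [Finset.sum_apply, ← sum_indicator_graph e f fun q => cubeVertex (blockVertex q) j]
    simp only [basePoint, Matrix.mulVec, dotProduct, W, Matrix.of_apply]
    refine Finset.sum_congr rfl fun k _ => ?_
    simp [Set.indicator_apply]
  have hbest : ∀ v i, basePoint W {k | (e k).2 = bestVertex v i (e k).1} =
      ∑ a, cubeVertex (bestVertex v i a) := by
    intro v i
    rw [hpt]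
    simp only [blockVertex_bestVertex]
  have hsub : Set.range (fun q : (Fin d → Bool) × Fin d =>
      ∑ a, cubeVertex (bestVertex q.1 q.2 a)) ⊆ polytopeVertices (projectionPolytope W S) := by
    rintro _ ⟨⟨v, i⟩, rfl⟩
    refine mem_extremePoints_convexHull_of_forall_lt
      ⟨_, ⟨{k | (e k).2 = bestVertex v i (e k).1}, ⟨_, rfl⟩, rfl⟩, hbest v i⟩
      (cubeFunctional v i) ?_
    rintro _ ⟨_, ⟨_, ⟨f, rfl⟩, rfl⟩, rfl⟩ hne
    change basePoint W _ ≠ _ at hne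
    change basePoint W _ ⬝ᵥ _ < _
    rw [hpt] at hne ⊢
    rw [sum_dotProduct, sum_dotProduct]
    have hlt := fun a => dotProduct_blockVertex_lt hd v i (a, f a)
    obtain ⟨a, ha⟩ : ∃ a, blockVertex (a, f a) ≠ bestVertex v i a := by
      by_contra! h
      exact hne (by simp only [h])
    refine Finset.sum_lt_sum (fun b _ => ?_) ⟨a, Finset.mem_univ a, hlt a ha⟩
    by_cases hb : blockVertex (b, f b) = bestVertex v i b
    · rw [hb]
    · exact (hlt b hb).le
  have hcard := Set.ncard_le_ncard hsub (finite_vertices_of_isBinaryMatroid W S hS)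
  rwa [← Set.image_univ, Set.ncard_image_of_injective _ (injective_sum_cubeVertex hd),
    Set.ncard_univ, Nat.card_eq_fintype_card, Fintype.card_prod, Fintype.card_fun,
    Fintype.card_fin, Fintype.card_bool, mul_comm] at hcard

/-! ### Asymptotics and conclusion -/

/-- Termwise comparison with the binomial expansion of `(N + 1) ^ r`, using `C(N, k) ≤ N ^ k`. -/
theorem sum_range_choose_le (N r : ℕ) :
    ∑ k ∈ Finset.range (r + 1), N.choose k ≤ (N + 1) ^ r := by
  rw [add_pow]
  refine Finset.sum_le_sum fun k hk => ?_
  have hk' : k ≤ r := by simpa [Nat.lt_succ_iff] using hk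
  calc N.choose k ≤ N ^ k := Nat.choose_le_pow N k
    _ = N ^ k * 1 ^ (r - k) * 1 := by simp
    _ ≤ _ := Nat.mul_le_mul_left _ (Nat.choose_pos hk')

theorem projectionVertexBound_le {d : ℕ} (hd : 1 ≤ d) :
    projectionVertexBound d ≤ 2 * 3 ^ (d * (d - 1)) := by
  obtain ⟨r, rfl⟩ := Nat.exists_eq_add_of_le' hd
  have h3 : 3 ≤ 3 ^ (r + 1) := by
    rw [pow_succ]
    have := Nat.one_le_pow r 3 (by norm_num)
    omega
  rw [projectionVertexBound, pow_mul]
  refine Nat.mul_le_mul_left _ ((sum_range_choose_le _ r).trans ?_)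
  exact Nat.pow_le_pow_left (by omega) r

theorem theorem4p6 :
    (∀ d : ℕ, 1 ≤ d →
      IsGreatest (projectionVertexCounts d) (maxProjectionVertices d) ∧
      d * 2 ^ d ≤ maxProjectionVertices d ∧
      maxProjectionVertices d ≤ projectionVertexBound d) ∧
    ((fun d : ℕ => (projectionVertexBound d : ℝ)) =O[atTop]
      (fun d : ℕ => (3 : ℝ) ^ (d * (d - 1)))) ∧
    (∀ d : ℕ, 1 ≤ d → d ≤ 2 → d * 2 ^ d = projectionVertexBound d) ∧
    maxProjectionVertices 1 = 2 ∧
    maxProjectionVertices 2 = 8 := by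
  have hmain : ∀ d : ℕ, 1 ≤ d →
      IsGreatest (projectionVertexCounts d) (maxProjectionVertices d) ∧
      d * 2 ^ d ≤ maxProjectionVertices d ∧
      maxProjectionVertices d ≤ projectionVertexBound d := by
    intro d hd
    have hub : projectionVertexBound d ∈ upperBounds (projectionVertexCounts d) := by
      rintro _ ⟨n, S, W, hS, hW, rfl⟩
      exact ncard_vertices_le hd hS hW
    obtain ⟨m, hm, hdm⟩ := exists_le_projectionVertexCounts hd
    have hmem : maxProjectionVertices d ∈ projectionVertexCounts d :=
      Nat.sSup_mem ⟨m, hm⟩ ⟨_, hub⟩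
    exact ⟨⟨hmem, fun k hk => le_csSup ⟨_, hub⟩ hk⟩, hdm.trans (le_csSup ⟨_, hub⟩ hm), hub hmem⟩
  have h1 : projectionVertexBound 1 = 2 := by decide
  have h2 : projectionVertexBound 2 = 8 := by decide
  refine ⟨hmain, ?_, ?_, ?_, ?_⟩
  · refine IsBigO.of_bound 2 ?_
    filter_upwards [eventually_ge_atTop 1] with d hd
    rw [Real.norm_of_nonneg (by positivity), Real.norm_of_nonneg (by positivity)]
    exact_mod_cast projectionVertexBound_le hd
  · intro d hd hd'
    interval_cases d
    · rw [h1]; norm_num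
    · rw [h2]; norm_num
  · have := hmain 1 le_rfl
    rw [h1] at this
    omega
  · have := hmain 2 (by norm_num)
    rw [h2] at this
    omega
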